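/- Let $a,b$ be integers with $1<a<b$ and $\gcd(a,b)=1$. For real $x$ let $N_{a,b}(x)$ be the number of pairs $(p,q)$ of nonnegative integers with $a^pb^q\le x$, let $\chi_{S_{a,b}}$ be the characteristic function of $S_{a,b}=\{a^pb^q:p,q\in\mathbb Z_{\ge0}\}$, and for real $y$ put $B_1^*(\{y\})=\{y\}-\tfrac12$ if $y\notin\mathbb Z$ and $B_1^*(\{y\})=0$ if $y\in\mathbb Z$, where $\{y\}$ is the fractional part of $y$. Then for every real $x\ge 1$ $$\begin{aligned}N_{a,b}(x)&=\frac{\log(x)^2}{2\log(a)\log(b)}+\frac{\log(x)}{2\log(a)}+\frac{\log(x)}{2\log(b)}+\frac14+\frac{\log(a)}{12\log(b)}+\frac{\log(b)}{12\log(a)}\\&\quad-\frac12B_1^*\left(\left\{\frac{\log(x)}{\log(a)}\right\}\right)-\frac12B_1^*\left(\left\{\frac{\log(x)}{\log(b)}\right\}\right)\\&\quad-\frac1{2\pi}\left(\sum_{k=1}^\infty\frac{\cos\left(\frac{\pi k\log(b)}{\log(a)}\right)\cos\left(2\pi k\frac{\log(x)}{\log(a)}\right)}{k\sin\left(\frac{\pi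 k\log(b)}{\log(a)}\right)}+\sum_{k=1}^\infty\frac{\cos\left(\frac{\pi k\log(a)}{\log(b)}\right)\cos\left(2\pi k\frac{\log(x)}{\log(b)}\right)}{k\sin\left(\frac{\pi k\log(a)}{\log(b)}\right)}\right)+\frac12\chi_{S_{a,b}}(x).\end{aligned}$$ Here the sum of the two series means the limit, as $R\to\infty$, of the sum of the first series truncated at $k\le\lfloor R\log(a)\rfloor$ and the second truncated at $k\le\lfloor R\log(b)\rfloor$, where $R$ runs through real numbers for which $R\log(a)$ and $R\log(b)$ both have distance at least $\delta$ from every integer. For every $\delta>0$ the truncated sums converge to this same value along such $R$, and for some $\delta>0$ there are arbitrarily large such $R$. In particular, for every real $x\ge1$ the formula holds with $a=2$, $b=3$, that is, $$\begin{aligned}N_{2,3}(x)&=\frac{\log(x)^2}{2\log(2)\log(3)}+\frac{\log(x)}{2\log(2)}+\frac{\log(x)}{2\log(3)}+\frac14+\frac{\log(2)}{12\log(3)}+\frac{\log(3)}{12\log(2)}\\&\quad-\frac12B_1^*\left(\left\{\frac{\log(x)}{\log(2)}\right\}\right)-\frac12B_1^*\left(\left\{\frac{\log(x)}{\log(3)}\right\}\right)\\&\quad-\frac1{2\pi}\left(\sum_{k=1}^\infty\frac{\cos\left(\frac{\pi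 k\log(3)}{\log(2)}\right)\cos\left(2\pi k\frac{\log(x)}{\log(2)}\right)}{k\sin\left(\frac{\pi k\log(3)}{\log(2)}\right)}+\sum_{k=1}^\infty\frac{\cos\left(\frac{\pi k\log(2)}{\log(3)}\right)\cos\left(2\pi k\frac{\log(x)}{\log(3)}\right)}{k\sin\left(\frac{\pi k\log(2)}{\log(3)}\right)}\right)+\frac12\chi_{S_{2,3}}(x),\end{aligned}$$ with the series interpreted in the same way. -/

import Mathlib

/-- `N_{a,b}(x)`: the number of pairs `(p, q)` of nonnegative integers with `a ^ p * b ^ q ≤ x`. -/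
noncomputable def countN (a b : ℕ) (x : ℝ) : ℕ :=
  Set.ncard {pq : ℕ × ℕ | (a : ℝ) ^ pq.1 * (b : ℝ) ^ pq.2 ≤ x}

/-- `S_{a,b}`, the set of numbers `a ^ p * b ^ q` with `p, q` nonnegative integers, inside `ℝ`. -/
def smoothSet (a b : ℕ) : Set ℝ :=
  {y : ℝ | ∃ p q : ℕ, y = (a : ℝ) ^ p * (b : ℝ) ^ q}

/-- The characteristic function of `S_{a,b}`. -/
noncomputable def chiS (a b : ℕ) : ℝ → ℝ :=
  (smoothSet a b).indicator (fun _ => 1)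

open Classical in
/-- The function `y ↦ B₁^*({y})`: `{y} - 1/2` for `y` not an integer, and `0` for `y` an integer. -/
noncomputable def bernoulliStar (y : ℝ) : ℝ :=
  if ∃ n : ℤ, y = n then 0 else Int.fract y - 1 / 2

/-- The partial sum up to `K` of
`∑ cos (π k log b / log a) cos (2 π k log x / log a) / (k sin (π k log b / log a))`. -/
noncomputable def cotPartialSum (a b : ℕ) (x : ℝ) (K : ℕ) : ℝ :=
  ∑ k ∈ Finset.Icc 1 K,
    Real.cos (Real.pi * k * Real.log b / Real.log a) *
        Real.cos (2 * Real.pi * k * (Real.log x / Real.log a)) /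
      (k * Real.sin (Real.pi * k * Real.log b / Real.log a))

/-- The two series (the second one with `a` and `b` swapped), truncated at the common height `R`:
the first at `k ≤ R log a`, the second at `k ≤ R log b`. -/
noncomputable def truncatedSum (a b : ℕ) (x R : ℝ) : ℝ :=
  cotPartialSum a b x ⌊R * Real.log a⌋₊ + cotPartialSum b a x ⌊R * Real.log b⌋₊

/-- The truncation heights `R` for which both `R log a` and `R log b` have distance at least `δ`
from every integer. -/
def separatedHeights (a b : ℕ) (δ : ℝ) : Set ℝ :=
  {R : ℝ | ∀ n : ℤ, δ ≤ |R * Real.log a - n| ∧ δ ≤ |R * Real.log b - n|}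

/-- `L` is the joint value of the two series: the limit of `truncatedSum a b x R` as `R → ∞` with
`R log a` and `R log b` bounded away from the integers. Such heights exist beyond every bound, and
the limit is `L` for every choice of the distance `δ`. -/
def IsSeriesValue (a b : ℕ) (x L : ℝ) : Prop :=
  (∃ δ : ℝ, 0 < δ ∧ ∀ M : ℝ, ∃ R ∈ separatedHeights a b δ, M ≤ R) ∧
  ∀ δ : ℝ, 0 < δ →
    Filter.Tendsto (truncatedSum a b x)
      (Filter.atTop ⊓ Filter.principal (separatedHeights a b δ)) (nhds L)

/-!
Put `α = log a`, `β = log b`, `t = log x`. The terms of the two series are, up to sawtooth terms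
`sin (2πkt/α) / k` and `sin (2πkt/β) / k`, the residues of `cos (2πuz) / (z sin (παz) sin (πβz))`
with `u = t + (α + β) / 2` at its nonzero poles `k / α` and `k / β`. For `-(α + β) < t < 0`, that is
`2|u| < α + β`, the integrals over circles staying away from the poles tend to `0`, so that the
residue at the origin gives the value of the series; the sawtooth series are summed by Abel's limit
theorem. This is the formula for `t < 0`, where there is nothing to count. When `t` decreases by
`α`, both the series and the number of lattice points change by explicit amounts (sawtooth series,
respectively the points with `p = 0`), and these match, which carries the formula to all `t ≥ 0`.
-/

open Filter Topology
open scoped Real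

/-! ### The sawtooth series -/

theorem norm_geom_sum_le {𝕜 : Type*} [NormedField 𝕜] {z : 𝕜} (hz : ‖z‖ ≤ 1) (hz1 : z ≠ 1) (n : ℕ) :
    ‖∑ i ∈ Finset.range n, z ^ i‖ ≤ 2 / ‖z - 1‖ := by
  rw [geom_sum_eq hz1, norm_div]
  gcongr
  calc ‖z ^ n - 1‖ ≤ ‖z ^ n‖ + ‖(1 : 𝕜)‖ := norm_sub_le _ _
    _ ≤ 1 + 1 := by
      rw [norm_pow, norm_one]
      gcongr
      exact pow_le_one₀ (norm_nonneg z) hz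
    _ = 2 := one_add_one_eq_two

theorem cauchySeq_sum_pow_div {z : ℂ} (hz : ‖z‖ ≤ 1) (hz1 : z ≠ 1) :
    CauchySeq fun n : ℕ => ∑ i ∈ Finset.range n, z ^ i / i := by
  have hantitone : Antitone fun i : ℕ => 1 / ((i : ℝ) + 1) :=
    fun m n hmn => one_div_le_one_div_of_le (by positivity) (by gcongr)
  have hbound (n : ℕ) : ‖∑ i ∈ Finset.range n, z ^ (i + 1)‖ ≤ 2 / ‖z - 1‖ := by
    simp only [pow_succ, ← Finset.sum_mul, norm_mul]
    exact (mul_le_of_le_one_right (norm_nonneg _) hz).trans (norm_geom_sum_le hz hz1 n)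
  have hdirichlet := hantitone.cauchySeq_series_mul_of_tendsto_zero_of_bounded
    tendsto_one_div_add_atTop_nhds_zero_nat hbound
  refine (cauchySeq_shift 1).1 ?_
  simpa [Finset.sum_range_succ', div_eq_inv_mul] using hdirichlet

theorem one_sub_mem_slitPlane {z : ℂ} (hz : ‖z‖ ≤ 1) (hz1 : z ≠ 1) : 1 - z ∈ Complex.slitPlane := by
  refine Or.inl ?_
  rw [Complex.sub_re, Complex.one_re, sub_pos]
  refine lt_of_le_of_ne ((Complex.re_le_norm z).trans hz) fun hre => hz1 ?_
  have hnorm : z.re = ‖z‖ := le_antisymm (Complex.re_le_norm z) (hre ▸ hz)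
  have him := (Complex.nonneg_iff.1 (Complex.re_eq_norm.1 hnorm)).2
  exact Complex.ext hre him.symm

/- Inside the disc this is the Taylor series; on the boundary Dirichlet's test gives convergence and
Abel's theorem the value. -/
theorem tendsto_sum_pow_div {z : ℂ} (hz : ‖z‖ ≤ 1) (hz1 : z ≠ 1) :
    Tendsto (fun n : ℕ => ∑ i ∈ Finset.range n, z ^ i / i) atTop (𝓝 (-Complex.log (1 - z))) := by
  obtain ⟨l, hl⟩ := cauchySeq_tendsto_of_complete (cauchySeq_sum_pow_div hz hz1)
  have habel := Complex.tendsto_tsum_powerSeries_nhdsWithin_lt hl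
  rw [tendsto_map'_iff] at habel
  have hlog : Tendsto (fun r : ℝ => -Complex.log (1 - r * z)) (𝓝[<] 1)
      (𝓝 (-Complex.log (1 - z))) := by
    have hcont : ContinuousAt (fun r : ℝ => -Complex.log (1 - r * z)) 1 :=
      (ContinuousAt.clog (by fun_prop) (by simpa using one_sub_mem_slitPlane hz hz1)).neg
    simpa using hcont.tendsto.mono_left nhdsWithin_le_nhds
  have hvalue : l = -Complex.log (1 - z) := by
    refine tendsto_nhds_unique habel (hlog.congr' ?_)
    filter_upwards [Ioo_mem_nhdsLT zero_lt_one] with r hr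
    have hnorm : ‖(r : ℂ) * z‖ < 1 := by
      rw [norm_mul, Complex.norm_real, Real.norm_of_nonneg hr.1.le]
      exact (mul_le_of_le_one_right hr.1.le hz).trans_lt hr.2
    rw [← (Complex.hasSum_taylorSeries_neg_log hnorm).tsum_eq, Function.comp_apply]
    refine tsum_congr fun n => ?_
    rw [mul_pow]
    ring
  rwa [← hvalue]

theorem arg_one_sub_exp {θ : ℝ} (h0 : 0 < θ) (h1 : θ < 2 * π) :
    Complex.arg (1 - Complex.exp (θ * Complex.I)) = (θ - π) / 2 := by
  have hsin : 0 < 2 * Real.sin (θ / 2) :=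
    mul_pos two_pos (Real.sin_pos_of_pos_of_lt_pi (by linarith) (by linarith))
  have hpolar : (1 : ℂ) - Complex.exp (θ * Complex.I) = ((2 * Real.sin (θ / 2) : ℝ) : ℂ) *
      (Complex.cos (((θ - π) / 2 : ℝ) : ℂ) + Complex.sin (((θ - π) / 2 : ℝ) : ℂ) * Complex.I) := by
    have hcos_half : Real.cos ((θ - π) / 2) = Real.sin (θ / 2) := by
      rw [sub_div, Real.cos_sub_pi_div_two]
    have hsin_half : Real.sin ((θ - π) / 2) = -Real.cos (θ / 2) := by
      rw [sub_div, Real.sin_sub_pi_div_two]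
    have hcos : Real.cos θ = 1 - 2 * Real.sin (θ / 2) ^ 2 := by
      rw [← Real.cos_two_mul_eq_one_sub, mul_div_cancel₀ _ two_ne_zero]
    have hsin : Real.sin θ = 2 * Real.sin (θ / 2) * Real.cos (θ / 2) := by
      rw [← Real.sin_two_mul, mul_div_cancel₀ _ two_ne_zero]
    rw [Complex.exp_mul_I, ← Complex.ofReal_cos, ← Complex.ofReal_sin, ← Complex.ofReal_cos,
      ← Complex.ofReal_sin, hcos_half, hsin_half, hcos, hsin]
    push_cast
    ring
  rw [hpolar]
  exact Complex.arg_mul_cos_add_sin_mul_I hsin ⟨by linarith, by linarith⟩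

theorem bernoulliStar_intCast (n : ℤ) : bernoulliStar n = 0 := if_pos ⟨n, rfl⟩

theorem bernoulliStar_of_ne {y : ℝ} (hy : ∀ n : ℤ, y ≠ n) :
    bernoulliStar y = Int.fract y - 1 / 2 :=
  if_neg (not_exists.2 hy)

theorem bernoulliStar_sub_one (y : ℝ) : bernoulliStar (y - 1) = bernoulliStar y := by
  have hint : (∃ n : ℤ, y - 1 = n) ↔ ∃ n : ℤ, y = n :=
    ⟨fun ⟨n, hn⟩ => ⟨n + 1, by push_cast; linarith⟩, fun ⟨n, hn⟩ => ⟨n - 1, by push_cast; linarith⟩⟩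
  by_cases hy : ∃ n : ℤ, y = n
  · rw [bernoulliStar, bernoulliStar, if_pos hy, if_pos (hint.2 hy)]
  · rw [bernoulliStar, bernoulliStar, if_neg hy, if_neg (mt hint.1 hy), Int.fract_sub_one]

theorem arg_one_sub_exp_two_pi_mul {y : ℝ} (hy : ∀ n : ℤ, y ≠ n) :
    Complex.arg (1 - Complex.exp ((2 * π * y : ℝ) * Complex.I)) = π * bernoulliStar y := by
  have hpos : 0 < Int.fract y := Int.fract_pos.2 (hy ⌊y⌋)
  have hperiod : Complex.exp ((2 * π * y : ℝ) * Complex.I) =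
      Complex.exp ((2 * π * Int.fract y : ℝ) * Complex.I) := by
    refine Complex.exp_eq_exp_iff_exists_int.2 ⟨⌊y⌋, ?_⟩
    rw [Int.fract]
    push_cast
    ring
  rw [hperiod, arg_one_sub_exp (by positivity)
    (mul_lt_of_lt_one_right Real.two_pi_pos (Int.fract_lt_one y)), bernoulliStar_of_ne hy]
  ring

/-- The partial sum up to `K` of the Fourier series of `y ↦ -π B₁^*({y})`. -/
noncomputable def sawtoothSum (y : ℝ) (K : ℕ) : ℝ :=
  ∑ k ∈ Finset.Icc 1 K, Real.sin (2 * π * k * y) / k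

theorem sawtoothSum_eq_im (y : ℝ) (K : ℕ) :
    sawtoothSum y K =
      (∑ k ∈ Finset.range (K + 1), Complex.exp ((2 * π * y : ℝ) * Complex.I) ^ k / k).im := by
  rw [sawtoothSum, Complex.im_sum, Finset.range_eq_Ico, Finset.Ico_add_one_right_eq_Icc,
    ← Finset.add_sum_Ioc_eq_sum_Icc K.zero_le, ← Finset.Icc_add_one_left_eq_Ioc, zero_add]
  simp only [pow_zero, Nat.cast_zero, div_zero, Complex.zero_im, zero_add]
  refine Finset.sum_congr rfl fun k _ => ?_
  rw [← Complex.exp_nat_mul, ← mul_assoc, ← Complex.ofReal_natCast, ← Complex.ofReal_mul,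
    Complex.div_ofReal_im, Complex.exp_ofReal_mul_I_im]
  congr 2
  ring

theorem tendsto_sawtoothSum (y : ℝ) :
    Tendsto (sawtoothSum y) atTop (𝓝 (-π * bernoulliStar y)) := by
  by_cases hy : ∃ n : ℤ, y = n
  · obtain ⟨n, rfl⟩ := hy
    rw [bernoulliStar_intCast, mul_zero]
    refine tendsto_const_nhds.congr fun K => (Finset.sum_eq_zero fun k _ => ?_).symm
    rw [show 2 * π * (k : ℝ) * n = ((2 * k * n : ℤ) : ℝ) * π by push_cast; ring,
      Real.sin_int_mul_pi, zero_div]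
  push Not at hy
  set z := Complex.exp ((2 * π * y : ℝ) * Complex.I) with hz
  have hz1 : z ≠ 1 := by
    rw [hz, Ne, Complex.exp_eq_one_iff]
    rintro ⟨n, hn⟩
    refine hy n (Complex.ofReal_injective ?_)
    refine mul_right_cancel₀ Complex.two_pi_I_ne_zero ?_
    push_cast at hn ⊢
    linear_combination hn
  have hlim := (Complex.continuous_im.tendsto _).comp <| (tendsto_add_atTop_iff_nat 1).2 <|
    tendsto_sum_pow_div (Complex.norm_exp_ofReal_mul_I _).le hz1
  rw [Complex.neg_im, Complex.log_im, arg_one_sub_exp_two_pi_mul hy, ← neg_mul] at hlim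
  exact hlim.congr fun K => (sawtoothSum_eq_im y K).symm

/-! ### Residues in a disc -/

section Residues

variable {E : Type*} [NormedAddCommGroup E] [NormedSpace ℂ E]

theorem differentiableAt_simplePole {w z : ℂ} (r : E) (hz : z ≠ w) :
    DifferentiableAt ℂ (fun z => (z - w)⁻¹ • r) z :=
  DifferentiableAt.smul_const (by fun_prop (disch := exact sub_ne_zero.2 hz)) r

theorem tendsto_sub_smul_of_eq_sub_simplePole {f g : ℂ → E} {v w : ℂ} {r s : E} (hvw : v ≠ w)
    (hg : ∀ z ≠ w, g z = f z - (z - w)⁻¹ • r)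
    (hf : Tendsto (fun z => (z - v) • f z) (𝓝[≠] v) (𝓝 s)) :
    Tendsto (fun z => (z - v) • g z) (𝓝[≠] v) (𝓝 s) := by
  have hregular : ContinuousAt (fun z => (z - v) • (z - w)⁻¹ • r) v :=
    ContinuousAt.smul (by fun_prop) (differentiableAt_simplePole r hvw).continuousAt
  have hlim := hf.sub (hregular.tendsto.mono_left nhdsWithin_le_nhds)
  rw [sub_self, zero_smul, sub_zero] at hlim
  refine hlim.congr' ?_
  filter_upwards [nhdsWithin_le_nhds (isOpen_ne.mem_nhds hvw)] with z hz
  rw [hg z hz, smul_sub]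

theorem continuousOn_sphere_of_differentiableAt {ι : Type*} {s : Finset ι} {p : ι → ℂ} {f : ℂ → E}
    {c : ℂ} {R : ℝ} (hball : ∀ i ∈ s, p i ∈ Metric.ball c R)
    (hf : ∀ z ∈ Metric.closedBall c R, (∀ i ∈ s, z ≠ p i) → DifferentiableAt ℂ f z) :
    ContinuousOn f (Metric.sphere c R) := fun z hz =>
  (hf z (Metric.sphere_subset_closedBall hz) fun i hi =>
    Metric.sphere_disjoint_ball.ne_of_mem hz (hball i hi)).continuousAt.continuousWithinAt

variable [CompleteSpace E]

theorem exists_differentiableAt_eq_sub_simplePole {f : ℂ → E} {w : ℂ} {r : E}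
    (hf : ∀ᶠ z in 𝓝[≠] w, DifferentiableAt ℂ f z)
    (hr : Tendsto (fun z => (z - w) • f z) (𝓝[≠] w) (𝓝 r)) :
    ∃ g : ℂ → E, DifferentiableAt ℂ g w ∧ ∀ z ≠ w, g z = f z - (z - w)⁻¹ • r := by
  set F : ℂ → E := Function.update (fun z => (z - w) • f z) w r
  have hFne {z : ℂ} (hz : z ≠ w) : F z = (z - w) • f z := Function.update_of_ne hz _ _
  have hFw : F w = r := Function.update_self _ _ _
  obtain ⟨s, hs, hsf⟩ := (eventually_nhdsWithin_iff.1 hf).exists_mem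
  have hdiff : DifferentiableOn ℂ F s := by
    refine (Complex.differentiableOn_compl_singleton_and_continuousAt_iff hs).1 ⟨?_, ?_⟩
    · intro z hz
      refine DifferentiableAt.differentiableWithinAt ?_
      refine DifferentiableAt.congr_of_eventuallyEq
        ((differentiableAt_id.sub_const w).smul (hsf z hz.1 hz.2)) ?_
      filter_upwards [isOpen_ne.mem_nhds hz.2] with y hy using hFne hy
    · exact continuousAt_update_same.2 hr
  refine ⟨dslope F w, ((Complex.differentiableOn_dslope hs).2 hdiff).differentiableAt hs,
    fun z hz => ?_⟩
  rw [dslope_of_ne _ hz, slope_def_module, hFne hz, hFw, smul_sub,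
    inv_smul_smul₀ (sub_ne_zero.2 hz)]

theorem circleIntegral_sub_simplePole {f : ℂ → E} {c w : ℂ} {R : ℝ}
    (hf : ContinuousOn f (Metric.sphere c R)) (hw : w ∈ Metric.ball c R) (r : E) :
    (∮ z in C(c, R), f z - (z - w)⁻¹ • r) = (∮ z in C(c, R), f z) - (2 * π * Complex.I) • r := by
  have hR : 0 ≤ R := dist_nonneg.trans (Metric.mem_ball.1 hw).le
  have hpole : ContinuousOn (fun z => (z - w)⁻¹ • r) (Metric.sphere c R) := fun z hz =>
    (differentiableAt_simplePole r
      (Metric.sphere_disjoint_ball.ne_of_mem hz hw)).continuousAt.continuousWithinAt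
  rw [circleIntegral.integral_sub (hf.circleIntegrable hR) (hpole.circleIntegrable hR),
    circleIntegral.integral_smul_const, circleIntegral.integral_sub_inv_of_mem_ball hw]

theorem circleIntegral_eq_sum_residues {ι : Type*} {s : Finset ι} {p : ι → ℂ} {r : ι → E}
    {f : ℂ → E} {c : ℂ} {R : ℝ} (hR : 0 ≤ R) (hp : Set.InjOn p s)
    (hball : ∀ i ∈ s, p i ∈ Metric.ball c R)
    (hf : ∀ z ∈ Metric.closedBall c R, (∀ i ∈ s, z ≠ p i) → DifferentiableAt ℂ f z)
    (hr : ∀ i ∈ s, Tendsto (fun z => (z - p i) • f z) (𝓝[≠] p i) (𝓝 (r i))) :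
    (∮ z in C(c, R), f z) = (2 * π * Complex.I) • ∑ i ∈ s, r i := by
  classical
  induction s using Finset.induction_on generalizing f with
  | empty =>
    rw [Finset.sum_empty, smul_zero]
    have hdiff : ∀ z ∈ Metric.closedBall c R, DifferentiableAt ℂ f z := by simpa using hf
    exact Complex.circleIntegral_eq_zero_of_differentiable_on_off_countable hR Set.countable_empty
      (fun z hz => (hdiff z hz).continuousAt.continuousWithinAt)
      fun z hz => hdiff z (Metric.ball_subset_closedBall hz.1)
  | insert i s hi ih =>
    have hcont := continuousOn_sphere_of_differentiableAt hball hf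
    rw [Finset.coe_insert, Set.injOn_insert (by simpa using hi)] at hp
    simp only [Finset.forall_mem_insert] at hball hr
    simp only [Finset.forall_mem_insert, and_imp] at hf
    have hmem : ∀ᶠ z in 𝓝 (p i), z ∈ Metric.closedBall c R :=
      Metric.closedBall_mem_nhds_of_mem hball.1
    have havoid : ∀ᶠ z in 𝓝 (p i), ∀ j ∈ s, z ≠ p j :=
      (Finset.eventually_all s).2 fun j hj =>
        isOpen_ne.mem_nhds fun hij => hp.2 ⟨j, hj, hij.symm⟩
    obtain ⟨g, hgi, hg⟩ : ∃ g : ℂ → E, DifferentiableAt ℂ g (p i) ∧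
        ∀ z ≠ p i, g z = f z - (z - p i)⁻¹ • r i := by
      refine exists_differentiableAt_eq_sub_simplePole ?_ hr.1
      filter_upwards [self_mem_nhdsWithin, nhdsWithin_le_nhds havoid, nhdsWithin_le_nhds hmem]
        with z hzi hzs hz using hf z hz hzi hzs
    have hg_diff (z : ℂ) (hz : z ∈ Metric.closedBall c R) (hzs : ∀ j ∈ s, z ≠ p j) :
        DifferentiableAt ℂ g z := by
      rcases eq_or_ne z (p i) with rfl | hzi
      · exact hgi
      · refine ((hf z hz hzi hzs).sub
          (differentiableAt_simplePole (r i) hzi)).congr_of_eventuallyEq ?_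
        filter_upwards [isOpen_ne.mem_nhds hzi] with y hy using hg y hy
    have hg_residue (j : ι) (hj : j ∈ s) :
        Tendsto (fun z => (z - p j) • g z) (𝓝[≠] p j) (𝓝 (r j)) :=
      tendsto_sub_smul_of_eq_sub_simplePole (fun h => hp.2 ⟨j, hj, h⟩) hg (hr.2 j hj)
    have hstep := ih hp.1 hball.2 hg_diff hg_residue
    rw [circleIntegral.integral_congr hR fun z hz =>
      hg z (Metric.sphere_disjoint_ball.ne_of_mem hz hball.1),
      circleIntegral_sub_simplePole hcont hball.1, sub_eq_iff_eq_add'] at hstep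
    rw [Finset.sum_insert hi, smul_add, hstep]

end Residues

/-! ### Integrals of the kernel over large circles -/

theorem norm_sin_sq (w : ℂ) :
    ‖Complex.sin w‖ ^ 2 = Real.sin w.re ^ 2 + Real.sinh w.im ^ 2 := by
  have hsin := Complex.sin_eq w
  rw [← Complex.ofReal_sin, ← Complex.ofReal_cos, ← Complex.ofReal_sinh, ← Complex.ofReal_cosh,
    ← Complex.ofReal_mul, ← Complex.ofReal_mul] at hsin
  rw [hsin, Complex.sq_norm, Complex.normSq_add_mul_I]
  linear_combination Real.sin w.re ^ 2 * Real.cosh_sq w.im +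
    Real.sinh w.im ^ 2 * Real.sin_sq_add_cos_sq w.re

theorem abs_sin_re_le_norm_sin (w : ℂ) : |Real.sin w.re| ≤ ‖Complex.sin w‖ :=
  abs_le_of_sq_le_sq (norm_sin_sq w ▸ le_add_of_nonneg_right (sq_nonneg _)) (norm_nonneg _)

theorem abs_sinh_im_le_norm_sin (w : ℂ) : |Real.sinh w.im| ≤ ‖Complex.sin w‖ :=
  abs_le_of_sq_le_sq (norm_sin_sq w ▸ le_add_of_nonneg_left (sq_nonneg _)) (norm_nonneg _)

theorem norm_cos_le_exp_abs_im (w : ℂ) : ‖Complex.cos w‖ ≤ Real.exp |w.im| := by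
  rw [Complex.cos, norm_div, Complex.norm_ofNat, div_le_iff₀ two_pos, mul_two]
  refine (norm_add_le _ _).trans (add_le_add ?_ ?_)
  · rw [Complex.norm_exp, Complex.mul_I_re]
    exact Real.exp_le_exp.2 (neg_le_abs _)
  · rw [Complex.norm_exp, neg_mul, Complex.neg_re, Complex.mul_I_re, neg_neg]
    exact Real.exp_le_exp.2 (le_abs_self _)

theorem two_mul_le_abs_sin_pi_mul {x η : ℝ} (hη : ∀ n : ℤ, η ≤ |x - n|) :
    2 * η ≤ |Real.sin (π * x)| := by
  have hround : |Real.sin (π * x)| = |Real.sin (π * (x - round x))| := by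
    rw [mul_sub, mul_comm π (round x : ℝ), Real.sin_sub_int_mul_pi, abs_mul, abs_zpow, abs_neg,
      abs_one, one_zpow, one_mul]
  have habs : |π * (x - round x)| = π * |x - round x| := by rw [abs_mul, abs_of_pos Real.pi_pos]
  calc 2 * η ≤ 2 * |x - round x| := by gcongr; exact hη _
    _ = 2 / π * |π * (x - round x)| := by rw [habs]; field_simp
    _ ≤ |Real.sin (π * (x - round x))| := by
      refine Real.mul_abs_le_abs_sin ?_
      rw [habs]
      linarith [mul_le_mul_of_nonneg_left (abs_sub_round x) Real.pi_pos.le]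
    _ = |Real.sin (π * x)| := hround.symm

theorem one_sub_exp_mul_exp_le_abs_sinh {y η : ℝ} (h : η ≤ |y|) :
    (1 - Real.exp (-(2 * η))) / 2 * Real.exp |y| ≤ |Real.sinh y| := by
  have hexp : Real.exp (-|y|) ≤ Real.exp (-(2 * η)) * Real.exp |y| := by
    rw [← Real.exp_add]
    exact Real.exp_le_exp.2 (by linarith)
  rw [Real.abs_sinh, Real.sinh_eq]
  linarith

/- Far from the real axis `sinh (π Im w)` gives the bound; near it the distance from `Re w` to the
integers does. -/
theorem exists_mul_exp_le_norm_sin {δ : ℝ} (hδ : 0 < δ) :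
    ∃ c : ℝ, 0 < c ∧ ∀ w : ℂ, (∀ n : ℤ, δ ≤ ‖w - n‖) →
      c * Real.exp (π * |w.im|) ≤ ‖Complex.sin (π * w)‖ := by
  have hπ := Real.pi_pos
  have hfar_pos : 0 < (1 - Real.exp (-(2 * (π * (δ / 2))))) / 2 :=
    half_pos (sub_pos.2 (Real.exp_lt_one_iff.2 (by linarith [mul_pos hπ hδ])))
  refine ⟨min ((1 - Real.exp (-(2 * (π * (δ / 2))))) / 2) (δ * Real.exp (-(π * (δ / 2)))),
    lt_min hfar_pos (by positivity), fun w hw => ?_⟩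
  have him : |((π : ℂ) * w).im| = π * |w.im| := by
    rw [Complex.im_ofReal_mul, abs_mul, abs_of_pos hπ]
  rcases le_or_gt (δ / 2) |w.im| with hfar | hnear
  · have hsinh := one_sub_exp_mul_exp_le_abs_sinh (y := ((π : ℂ) * w).im) (η := π * (δ / 2))
      (by rw [him]; gcongr)
    rw [him] at hsinh
    exact (mul_le_mul_of_nonneg_right (min_le_left _ _) (Real.exp_pos _).le).trans
      (hsinh.trans (abs_sinh_im_le_norm_sin _))
  · have hre (n : ℤ) : δ / 2 ≤ |w.re - n| := by
      have htri := (hw n).trans (Complex.norm_le_abs_re_add_abs_im (w - n))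
      rw [Complex.sub_re, Complex.sub_im, Complex.intCast_re, Complex.intCast_im, sub_zero] at htri
      linarith
    calc _ ≤ δ * Real.exp (-(π * (δ / 2))) * Real.exp (π * (δ / 2)) := by
          gcongr
          exact min_le_right _ _
      _ = 2 * (δ / 2) := by rw [mul_assoc, ← Real.exp_add, neg_add_cancel, Real.exp_zero]; ring
      _ ≤ |Real.sin (π * w.re)| := two_mul_le_abs_sin_pi_mul hre
      _ ≤ ‖Complex.sin (π * w)‖ := by
          rw [← Complex.re_ofReal_mul]
          exact abs_sin_re_le_norm_sin _

/-- The truncation heights `R` at which `R * α` and `R * β` have distance at least `δ` from every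
integer: circles of such radius stay away from the poles of `cosSinKernel`. -/
def separatedReals (α β δ : ℝ) : Set ℝ :=
  {R : ℝ | ∀ n : ℤ, δ ≤ |R * α - n| ∧ δ ≤ |R * β - n|}

/-- The filter of truncation heights tending to infinity inside `separatedReals α β δ`. -/
def separatedAtTop (α β δ : ℝ) : Filter ℝ :=
  atTop ⊓ 𝓟 (separatedReals α β δ)

theorem separatedAtTop_le_atTop (α β δ : ℝ) : separatedAtTop α β δ ≤ atTop := inf_le_left

theorem eventually_mem_separatedReals (α β δ : ℝ) :
    ∀ᶠ R in separatedAtTop α β δ, R ∈ separatedReals α β δ :=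
  mem_inf_of_right (mem_principal_self _)

theorem separatedReals_comm (α β δ : ℝ) : separatedReals α β δ = separatedReals β α δ :=
  Set.ext fun _ => forall_congr' fun _ => and_comm

theorem le_abs_sub_intCast {m : ℤ} {y η : ℝ} (h0 : m + η ≤ y) (h1 : y ≤ m + 1 - η) (n : ℤ) :
    η ≤ |y - n| := by
  rcases le_or_gt n m with hn | hn
  · have hn' : (n : ℝ) ≤ m := by exact_mod_cast hn
    exact (by linarith : η ≤ y - n).trans (le_abs_self _)
  · have hn' : (m : ℝ) + 1 ≤ n := by exact_mod_cast hn
    exact (by linarith : η ≤ -(y - n)).trans (neg_le_abs _)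

/- Start with `R * α` a quarter above an integer. If `R * β` is close to an integer, increasing it
by `1 / 4` repairs this and moves `R * α` by at most `1 / 4`. -/
theorem exists_mem_separatedReals_of_le {α β : ℝ} (hα : 0 < α) (hαβ : α ≤ β) (M : ℝ) :
    ∃ R ∈ separatedReals α β (1 / 8), M ≤ R := by
  have hβ : 0 < β := hα.trans_le hαβ
  obtain ⟨N, hN⟩ := exists_int_gt (M * α)
  obtain ⟨R, hR⟩ : ∃ R : ℝ, R * α = N + 1 / 4 := ⟨(N + 1 / 4) / α, div_mul_cancel₀ _ hα.ne'⟩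
  have hMR : M ≤ R := le_of_mul_le_mul_right (by linarith) hα
  by_cases hRβ : ∀ n : ℤ, 1 / 8 ≤ |R * β - n|
  · exact ⟨R, fun n => ⟨le_abs_sub_intCast (m := N) (by linarith) (by linarith) n, hRβ n⟩, hMR⟩
  push Not at hRβ
  obtain ⟨m, hm⟩ := hRβ
  rw [abs_lt] at hm
  have hshift : 0 ≤ 1 / (4 * β) := by positivity
  have hshiftα : 1 / (4 * β) * α ≤ 1 / 4 := by
    rw [div_mul_eq_mul_div, div_le_div_iff₀ (by positivity) (by norm_num)]
    linarith
  have hshiftα_nonneg : 0 ≤ 1 / (4 * β) * α := by positivity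
  have hshiftβ : 1 / (4 * β) * β = 1 / 4 := by field_simp
  refine ⟨R + 1 / (4 * β), fun n => ⟨le_abs_sub_intCast (m := N) ?_ ?_ n,
    le_abs_sub_intCast (m := m) ?_ ?_ n⟩, by linarith⟩
  all_goals rw [add_mul]; linarith

theorem exists_mem_separatedReals {α β : ℝ} (hα : 0 < α) (hβ : 0 < β) (M : ℝ) :
    ∃ R ∈ separatedReals α β (1 / 8), M ≤ R := by
  rcases le_total α β with hαβ | hβα
  · exact exists_mem_separatedReals_of_le hα hαβ M
  · rw [separatedReals_comm]
    exact exists_mem_separatedReals_of_le hβ hβα M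

theorem le_norm_mul_sub_intCast {γ δ : ℝ} {z : ℂ} (hγ : 0 ≤ γ)
    (hz : ∀ n : ℤ, δ ≤ |‖z‖ * γ - n|) (n : ℤ) : δ ≤ ‖(γ : ℂ) * z - n‖ := by
  have hreverse := abs_norm_sub_norm_le ((γ : ℂ) * z) n
  rw [norm_mul, Complex.norm_real, Real.norm_of_nonneg hγ, mul_comm γ, Complex.norm_intCast,
    ← Int.cast_abs] at hreverse
  exact (hz |n|).trans hreverse

/-- The function `cos (2πuz) / (z sin (παz) sin (πβz))`, whose residues at the nonzero poles are the
terms of the two series. Subtracting the leading term of its expansion at the origin turns the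
triple pole there into a simple one and does not change the residue. -/
noncomputable def cosSinKernel (α β u : ℝ) (z : ℂ) : ℂ :=
  Complex.cos (2 * π * u * z) / (z * (Complex.sin (π * (α * z)) * Complex.sin (π * (β * z)))) -
    1 / (π ^ 2 * α * β * z ^ 3)

theorem cosSinKernel_comm (α β u : ℝ) : cosSinKernel α β u = cosSinKernel β α u := by
  funext z
  rw [cosSinKernel, cosSinKernel, mul_comm (Complex.sin (π * (α * z))),
    mul_right_comm (_ : ℂ) (α : ℂ) (β : ℂ)]

theorem mul_cosSinKernel (α β u : ℝ) {z : ℂ} (hz : z ≠ 0) :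
    z * cosSinKernel α β u z =
      Complex.cos (2 * π * u * z) / (Complex.sin (π * (α * z)) * Complex.sin (π * (β * z))) -
        1 / (π ^ 2 * α * β * z ^ 2) := by
  have hpow : (π : ℂ) ^ 2 * α * β * z ^ 3 = z * (π ^ 2 * α * β * z ^ 2) := by ring
  rw [cosSinKernel, hpow, mul_sub, mul_div_assoc', mul_div_assoc', mul_div_mul_left _ _ hz,
    mul_div_mul_left _ _ hz]

theorem exists_norm_mul_cosSinKernel_le {α β δ : ℝ} (hα : 0 < α) (hβ : 0 < β) (hδ : 0 < δ)
    (u : ℝ) : ∃ C : ℝ, ∀ z : ℂ, z ≠ 0 → ‖z‖ ∈ separatedReals α β δ →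
      ‖z * cosSinKernel α β u z‖ ≤
        C * Real.exp (-(π * (α + β - 2 * |u|) * |z.im|)) + 1 / (π ^ 2 * α * β * ‖z‖ ^ 2) := by
  obtain ⟨c, hc, hsin⟩ := exists_mul_exp_le_norm_sin hδ
  refine ⟨1 / (c * c), fun z hz hsep => ?_⟩
  have him (γ : ℝ) : ((γ : ℂ) * z).im = γ * z.im := Complex.im_ofReal_mul γ z
  have hsinα := hsin _ (le_norm_mul_sub_intCast hα.le fun n => (hsep n).1)
  have hsinβ := hsin _ (le_norm_mul_sub_intCast hβ.le fun n => (hsep n).2)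
  rw [him, abs_mul, abs_of_pos hα] at hsinα
  rw [him, abs_mul, abs_of_pos hβ] at hsinβ
  have hcos : ‖Complex.cos (2 * π * u * z)‖ ≤ Real.exp (2 * π * |u| * |z.im|) := by
    convert norm_cos_le_exp_abs_im (2 * π * u * z) using 2
    rw [show 2 * (π : ℂ) * u * z = ((2 * π * u : ℝ) : ℂ) * z by push_cast; rfl, him, abs_mul,
      abs_mul, abs_of_pos Real.two_pi_pos]
  rw [mul_cosSinKernel α β u hz]
  refine (norm_sub_le _ _).trans (add_le_add ?_ (le_of_eq ?_))
  · rw [norm_div, norm_mul]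
    calc _ ≤ Real.exp (2 * π * |u| * |z.im|) /
          (c * Real.exp (π * (α * |z.im|)) * (c * Real.exp (π * (β * |z.im|)))) := by
          gcongr
      _ = _ := by
          rw [show -(π * (α + β - 2 * |u|) * |z.im|) =
            2 * π * |u| * |z.im| - (π * (α * |z.im|) + π * (β * |z.im|)) by ring,
            Real.exp_sub, Real.exp_add]
          field_simp
  · simp [abs_of_pos hα, abs_of_pos hβ]

theorem tendsto_integral_exp_neg_mul_abs_sin {κ : ℝ} (hκ : 0 < κ) (a b : ℝ) :
    Tendsto (fun R : ℝ => ∫ θ in a..b, Real.exp (-(κ * (R * |Real.sin θ|)))) atTop (𝓝 0) := by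
  have hsin : ∀ᵐ θ : ℝ, Real.sin θ ≠ 0 := by
    have hcountable : {θ : ℝ | Real.sin θ = 0}.Countable :=
      (Set.countable_range fun n : ℤ => (n : ℝ) * π).mono fun _ hθ => Real.sin_eq_zero_iff.1 hθ
    exact MeasureTheory.compl_mem_ae_iff.2 (hcountable.measure_zero _)
  have hlim := intervalIntegral.tendsto_integral_filter_of_dominated_convergence
    (μ := MeasureTheory.volume) (a := a) (b := b) (f := fun _ => (0 : ℝ)) (l := atTop)
    (F := fun R θ => Real.exp (-(κ * (R * |Real.sin θ|)))) (fun _ => 1) ?_ ?_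
    intervalIntegrable_const ?_
  · simpa only [intervalIntegral.integral_zero] using hlim
  · exact Eventually.of_forall fun R => Continuous.aestronglyMeasurable (by fun_prop)
  · filter_upwards [eventually_ge_atTop 0] with R hR
    refine Eventually.of_forall fun θ _ => ?_
    rw [Real.norm_of_nonneg (Real.exp_pos _).le, Real.exp_le_one_iff, neg_nonpos]
    positivity
  · filter_upwards [hsin] with θ hθ _
    refine Real.tendsto_exp_neg_atTop_nhds_zero.comp ?_
    exact (tendsto_id.atTop_mul_const (abs_pos.2 hθ)).const_mul_atTop hκ

theorem tendsto_circleIntegral_of_norm_smul_le {E : Type*} [NormedAddCommGroup E] [NormedSpace ℂ E]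
    {f : ℂ → E} {l : Filter ℝ} {C κ : ℝ} {ε : ℝ → ℝ} (hl : l ≤ atTop) (hκ : 0 < κ)
    (hε : Tendsto ε l (𝓝 0))
    (hf : ∀ᶠ R in l, ∀ z : ℂ, ‖z‖ = R → ‖z • f z‖ ≤ C * Real.exp (-(κ * |z.im|)) + ε R) :
    Tendsto (fun R : ℝ => ∮ z in C(0, R), f z) l (𝓝 0) := by
  have hbound : Tendsto (fun R : ℝ => ∫ θ in (0 : ℝ)..2 * π,
      (C * Real.exp (-(κ * (R * |Real.sin θ|))) + ε R)) l (𝓝 0) := by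
    have hlim := (((tendsto_integral_exp_neg_mul_abs_sin hκ 0 (2 * π)).mono_left hl).const_mul
      C).add (hε.const_mul (2 * π))
    rw [mul_zero, mul_zero, add_zero] at hlim
    refine hlim.congr fun R => ?_
    rw [intervalIntegral.integral_add (Continuous.intervalIntegrable (by fun_prop) _ _)
      intervalIntegrable_const, intervalIntegral.integral_const_mul,
      intervalIntegral.integral_const, sub_zero, smul_eq_mul]
  refine squeeze_zero_norm' ?_ hbound
  filter_upwards [hf, hl (eventually_ge_atTop 0)] with R hR hR0
  refine intervalIntegral.norm_integral_le_of_norm_le Real.two_pi_pos.le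
    (Eventually.of_forall fun θ _ => ?_) (Continuous.intervalIntegrable (by fun_prop) _ _)
  have hz := hR (circleMap 0 R θ) (by rw [norm_circleMap_zero, abs_of_nonneg hR0])
  rw [circleMap_zero_im, abs_mul, abs_of_nonneg hR0] at hz
  rwa [deriv_circleMap, mul_comm, mul_smul, norm_smul, Complex.norm_I, one_mul]

theorem tendsto_circleIntegral_cosSinKernel {α β u δ : ℝ} (hα : 0 < α) (hβ : 0 < β) (hδ : 0 < δ)
    (hu : 2 * |u| < α + β) :
    Tendsto (fun R : ℝ => ∮ z in C(0, R), cosSinKernel α β u z) (separatedAtTop α β δ) (𝓝 0) := by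
  obtain ⟨C, hC⟩ := exists_norm_mul_cosSinKernel_le hα hβ hδ u
  have hle := separatedAtTop_le_atTop α β δ
  have hε : Tendsto (fun R : ℝ => 1 / (π ^ 2 * α * β * R ^ 2)) atTop (𝓝 0) :=
    tendsto_const_nhds.div_atTop
      ((tendsto_pow_atTop two_ne_zero).const_mul_atTop (by positivity))
  refine tendsto_circleIntegral_of_norm_smul_le (C := C) hle
    (mul_pos Real.pi_pos (sub_pos.2 hu)) (hε.mono_left hle) ?_
  filter_upwards [eventually_mem_separatedReals α β δ, hle (eventually_gt_atTop 0)]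
    with _ hsep hR z rfl using hC z (norm_pos_iff.1 hR) hsep

/-! ### Residues of the kernel -/

theorem tendsto_div_pow_of_isBigO {f : ℂ → ℂ} {a : ℂ} {m n : ℕ} (hmn : m < n)
    (hf : (fun z => f z - a * z ^ m) =O[𝓝 0] fun z => z ^ n) :
    Tendsto (fun z => f z / z ^ m) (𝓝[≠] 0) (𝓝 a) := by
  have hlittle : (fun z => f z - a * z ^ m) =o[𝓝[≠] 0] fun z => z ^ m :=
    (hf.trans_isLittleO (Asymptotics.isLittleO_pow_pow hmn)).mono nhdsWithin_le_nhds
  rw [← tendsto_sub_nhds_zero_iff]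
  refine hlittle.tendsto_div_nhds_zero.congr' ?_
  filter_upwards [self_mem_nhdsWithin] with z (hz : z ≠ 0)
  rw [sub_div, mul_div_cancel_right₀ _ (pow_ne_zero m hz)]

theorem isBigO_comp_const_mul {f : ℂ → ℂ} {n : ℕ} (hf : f =O[𝓝 0] fun z => z ^ n) (c : ℂ) :
    (fun z => f (c * z)) =O[𝓝 0] fun z => z ^ n := by
  have hc : Tendsto (fun z : ℂ => c * z) (𝓝 0) (𝓝 0) := by
    simpa using (tendsto_id (x := 𝓝 (0 : ℂ))).const_mul c
  refine (hf.comp_tendsto hc).trans ?_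
  simp only [Function.comp_def, mul_pow]
  exact Asymptotics.isBigO_const_mul_self _ _ _

theorem tendsto_cos_mul_sub_one_div_sq (c : ℂ) :
    Tendsto (fun z : ℂ => (Complex.cos (c * z) - 1) / z ^ 2) (𝓝[≠] 0) (𝓝 (-c ^ 2 / 2)) := by
  have hcos : (fun z : ℂ => Complex.cos z - (1 - z ^ 2 / 2)) =O[𝓝 0] fun z => z ^ 4 := by
    refine Asymptotics.IsBigO.of_bound (5 / 96) ?_
    filter_upwards [Metric.closedBall_mem_nhds (0 : ℂ) one_pos] with z hz
    rw [norm_pow, mul_comm]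
    exact Complex.cos_bound (mem_closedBall_zero_iff.1 hz)
  refine tendsto_div_pow_of_isBigO (n := 4) (by norm_num)
    ((isBigO_comp_const_mul hcos c).congr_left fun z => ?_)
  ring

theorem tendsto_sin_mul_sub_div_cube (c : ℂ) :
    Tendsto (fun z : ℂ => (Complex.sin (c * z) - c * z) / z ^ 3) (𝓝[≠] 0) (𝓝 (-c ^ 3 / 6)) := by
  have hsin : (fun z : ℂ => Complex.sin z - (z - z ^ 3 / 6)) =O[𝓝 0] fun z => z ^ 5 := by
    refine Asymptotics.IsBigO.of_bound (1 / 100) ?_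
    filter_upwards [Metric.closedBall_mem_nhds (0 : ℂ) one_pos] with z hz
    rw [norm_pow, mul_comm]
    exact (Complex.sin_bound (mem_closedBall_zero_iff.1 hz)).trans_eq (by ring)
  refine tendsto_div_pow_of_isBigO (n := 5) (by norm_num)
    ((isBigO_comp_const_mul hsin c).congr_left fun z => ?_)
  ring

theorem tendsto_cos_div_sin_mul_sin {A B : ℂ} (hA : A ≠ 0) (hB : B ≠ 0) (c : ℂ) :
    Tendsto (fun z : ℂ => Complex.cos (c * z) / (Complex.sin (A * z) * Complex.sin (B * z)) -
      1 / (A * B * z ^ 2)) (𝓝[≠] 0) (𝓝 (((A ^ 2 + B ^ 2) / 6 - c ^ 2 / 2) / (A * B))) := by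
  have hcos := tendsto_cos_mul_sub_one_div_sq c
  have hsinA := tendsto_sin_mul_sub_div_cube A
  have hsinB := tendsto_sin_mul_sub_div_cube B
  set τ : ℂ → ℂ := fun z => (Complex.cos (c * z) - 1) / z ^ 2
  set σA : ℂ → ℂ := fun z => (Complex.sin (A * z) - A * z) / z ^ 3
  set σB : ℂ → ℂ := fun z => (Complex.sin (B * z) - B * z) / z ^ 3
  have hsq : Tendsto (fun z : ℂ => z ^ 2) (𝓝[≠] 0) (𝓝 0) := by
    simpa using ((continuous_pow 2).tendsto (0 : ℂ)).mono_left nhdsWithin_le_nhds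
  have hA_lim : Tendsto (fun z => A + z ^ 2 * σA z) (𝓝[≠] 0) (𝓝 A) := by
    simpa using (hsq.mul hsinA).const_add A
  have hB_lim : Tendsto (fun z => B + z ^ 2 * σB z) (𝓝[≠] 0) (𝓝 B) := by
    simpa using (hsq.mul hsinB).const_add B
  have hlim := ((((hcos.const_mul (A * B)).sub (hsinB.const_mul A)).sub (hsinA.const_mul B)).sub
    (hsq.mul (hsinA.mul hsinB))).div ((hA_lim.mul hB_lim).const_mul (A * B))
    (mul_ne_zero (mul_ne_zero hA hB) (mul_ne_zero hA hB))
  refine (hlim.congr' ?_).trans_eq (congrArg 𝓝 (by field_simp; ring))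
  filter_upwards [self_mem_nhdsWithin, hA_lim.eventually_ne hA, hB_lim.eventually_ne hB]
    with z (hz : z ≠ 0) hAz hBz
  have hcos_eq : Complex.cos (c * z) = 1 + z ^ 2 * τ z := by
    simp only [τ]
    field_simp
    ring
  have hsinA_eq : Complex.sin (A * z) = z * (A + z ^ 2 * σA z) := by
    simp only [σA]
    field_simp
    ring
  have hsinB_eq : Complex.sin (B * z) = z * (B + z ^ 2 * σB z) := by
    simp only [σB]
    field_simp
    ring
  rw [hcos_eq, hsinA_eq, hsinB_eq, Pi.div_apply]
  generalize hP : A + z ^ 2 * σA z = P at hAz ⊢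
  generalize hQ : B + z ^ 2 * σB z = Q at hBz ⊢
  field_simp
  rw [← hP, ← hQ]
  ring

theorem tendsto_mul_cosSinKernel_zero {α β : ℝ} (hα : α ≠ 0) (hβ : β ≠ 0) (u : ℝ) :
    Tendsto (fun z : ℂ => z * cosSinKernel α β u z) (𝓝[≠] 0)
      (𝓝 ((((α ^ 2 + β ^ 2) / 6 - 2 * u ^ 2) / (α * β) : ℝ) : ℂ)) := by
  have hπ : (π : ℂ) ≠ 0 := Complex.ofReal_ne_zero.2 Real.pi_ne_zero
  have hαC : (α : ℂ) ≠ 0 := Complex.ofReal_ne_zero.2 hα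
  have hβC : (β : ℂ) ≠ 0 := Complex.ofReal_ne_zero.2 hβ
  have hlim := tendsto_cos_div_sin_mul_sin (mul_ne_zero hπ hαC) (mul_ne_zero hπ hβC) (2 * π * u)
  have hval : (((π : ℂ) * α) ^ 2 + (π * β) ^ 2) / 6 - (2 * π * u) ^ 2 / 2 =
      π ^ 2 * ((α ^ 2 + β ^ 2) / 6 - 2 * u ^ 2) := by ring
  rw [hval, show (π : ℂ) * α * (π * β) = π ^ 2 * (α * β) by ring,
    mul_div_mul_left _ _ (pow_ne_zero 2 hπ)] at hlim
  push_cast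
  refine hlim.congr' ?_
  filter_upwards [self_mem_nhdsWithin] with z hz
  rw [mul_cosSinKernel α β u hz]
  simp only [mul_assoc]

theorem tendsto_sub_mul_div_of_hasDerivAt {𝕜 : Type*} [NontriviallyNormedField 𝕜] {g h : 𝕜 → 𝕜}
    {h' w : 𝕜} (hg : ContinuousAt g w) (hh : HasDerivAt h h' w) (hw : h w = 0) (hh' : h' ≠ 0) :
    Tendsto (fun z => (z - w) * (g z / h z)) (𝓝[≠] w) (𝓝 (g w / h')) := by
  refine ((hg.tendsto.mono_left nhdsWithin_le_nhds).div hh.tendsto_slope hh').congr fun z => ?_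
  rw [Pi.div_apply, slope_def_field, hw, sub_zero, div_div_eq_mul_div]
  ring

theorem sin_pi_mul_ne_zero_of_irrational {x : ℝ} (hx : Irrational x) {k : ℤ} (hk : k ≠ 0) :
    Real.sin (π * k * x) ≠ 0 := by
  rw [Ne, Real.sin_eq_zero_iff]
  rintro ⟨n, hn⟩
  refine (hx.intCast_mul hk).ne_int n (mul_right_cancel₀ Real.pi_ne_zero ?_)
  rw [hn]
  ring

/-- The residue of `cosSinKernel α β u` at the pole `k / α`, for `k ≠ 0`. -/
noncomputable def cosSinResidue (α β u : ℝ) (k : ℤ) : ℝ :=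
  Real.cos (2 * π * u * (k / α)) / (π * k * Real.cos (π * k) * Real.sin (π * k * (β / α)))

theorem cosSinResidue_neg (α β u : ℝ) (k : ℤ) :
    cosSinResidue α β u (-k) = cosSinResidue α β u k := by
  simp only [cosSinResidue, Int.cast_neg, neg_div, mul_neg, neg_mul, Real.cos_neg, Real.sin_neg,
    neg_neg]

theorem cos_pi_mul_intCast_ne_zero (k : ℤ) : Real.cos (π * k) ≠ 0 := by
  rw [mul_comm, Real.cos_int_mul_pi]
  exact zpow_ne_zero _ (by norm_num)

theorem sin_pi_mul_intCast_div_eq_zero {γ : ℝ} (hγ : γ ≠ 0) (k : ℤ) :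
    Complex.sin (π * (γ * ((k / γ : ℝ) : ℂ))) = 0 := by
  rw [← Complex.ofReal_mul, mul_div_cancel₀ _ hγ, Complex.ofReal_intCast, mul_comm,
    Complex.sin_int_mul_pi]

theorem hasDerivAt_sin_pi_mul_intCast_div {γ : ℝ} (hγ : γ ≠ 0) (k : ℤ) :
    HasDerivAt (fun z : ℂ => Complex.sin (π * (γ * z))) ((Real.cos (π * k) * (π * γ) : ℝ) : ℂ)
      ((k / γ : ℝ) : ℂ) := by
  have hlin := (((hasDerivAt_id ((k / γ : ℝ) : ℂ)).const_mul (γ : ℂ)).const_mul (π : ℂ)).csin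
  rw [mul_one, id, ← Complex.ofReal_mul, mul_div_cancel₀ _ hγ] at hlin
  exact_mod_cast hlin

theorem tendsto_sub_mul_cosSinKernel {α β : ℝ} (hα : α ≠ 0) (hirr : Irrational (β / α)) (u : ℝ)
    {k : ℤ} (hk : k ≠ 0) :
    Tendsto (fun z : ℂ => (z - ((k / α : ℝ) : ℂ)) * cosSinKernel α β u z)
      (𝓝[≠] ((k / α : ℝ) : ℂ)) (𝓝 (cosSinResidue α β u k : ℂ)) := by
  have hβ : β ≠ 0 := by
    rintro rfl
    exact hirr.ne_zero (zero_div α)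
  have hαC : (α : ℂ) ≠ 0 := Complex.ofReal_ne_zero.2 hα
  set w : ℂ := ((k / α : ℝ) : ℂ) with hw
  have hw0 : w ≠ 0 :=
    Complex.ofReal_ne_zero.2 (div_ne_zero (Int.cast_ne_zero.2 hk) hα)
  have hβw : (π : ℂ) * (β * w) = ((π * k * (β / α) : ℝ) : ℂ) := by
    rw [hw]
    push_cast
    ring
  have hsinβ : Complex.sin (π * (β * w)) ≠ 0 := by
    rw [hβw, ← Complex.ofReal_sin]
    exact Complex.ofReal_ne_zero.2 (sin_pi_mul_ne_zero_of_irrational hirr hk)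
  have hpole := tendsto_sub_mul_div_of_hasDerivAt
    (g := fun z => Complex.cos (2 * π * u * z) / (z * Complex.sin (π * (β * z))))
    (ContinuousAt.div (by fun_prop) (by fun_prop) (mul_ne_zero hw0 hsinβ))
    (hasDerivAt_sin_pi_mul_intCast_div hα k) (sin_pi_mul_intCast_div_eq_zero hα k)
    (Complex.ofReal_ne_zero.2 (mul_ne_zero (cos_pi_mul_intCast_ne_zero k)
      (mul_ne_zero Real.pi_ne_zero hα)))
  have hregular : ContinuousAt (fun z : ℂ => (z - w) * (1 / (π ^ 2 * α * β * z ^ 3))) w := by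
    have hπC : (π : ℂ) ≠ 0 := Complex.ofReal_ne_zero.2 Real.pi_ne_zero
    have hβC : (β : ℂ) ≠ 0 := Complex.ofReal_ne_zero.2 hβ
    refine ContinuousAt.mul (by fun_prop) (ContinuousAt.div (by fun_prop) (by fun_prop) ?_)
    positivity
  have hlim := hpole.sub (hregular.tendsto.mono_left nhdsWithin_le_nhds)
  rw [sub_self, zero_mul, sub_zero, hβw] at hlim
  convert hlim.congr fun z => ?_ using 2
  · rw [cosSinResidue, hw]
    push_cast
    field_simp
  · rw [cosSinKernel, mul_sub, div_div, mul_assoc z, mul_comm (Complex.sin (π * (β * z)))]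

theorem differentiableAt_cosSinKernel {α β : ℝ} (hα : α ≠ 0) (hβ : β ≠ 0) (u : ℝ) {z : ℂ}
    (hz : z ≠ 0) (hsinα : Complex.sin (π * (α * z)) ≠ 0)
    (hsinβ : Complex.sin (π * (β * z)) ≠ 0) :
    DifferentiableAt ℂ (cosSinKernel α β u) z := by
  have hπC : (π : ℂ) ≠ 0 := Complex.ofReal_ne_zero.2 Real.pi_ne_zero
  have hαC : (α : ℂ) ≠ 0 := Complex.ofReal_ne_zero.2 hα
  have hβC : (β : ℂ) ≠ 0 := Complex.ofReal_ne_zero.2 hβ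
  exact .sub (.div (by fun_prop) (by fun_prop) (mul_ne_zero hz (mul_ne_zero hsinα hsinβ)))
    (.div (by fun_prop) (by fun_prop) (by positivity))

/-- The nonzero integers of absolute value at most `K`. They index the nonzero zeros `k / γ` of
`sin (πγz)` inside a disc whose radius is a separated height. -/
noncomputable def nonzeroIntegers (K : ℕ) : Finset ℤ :=
  (Finset.Icc (-(K : ℤ)) K).erase 0

theorem mem_nonzeroIntegers {K : ℕ} {k : ℤ} : k ∈ nonzeroIntegers K ↔ k ≠ 0 ∧ k.natAbs ≤ K := by
  rw [nonzeroIntegers, Finset.mem_erase, Finset.mem_Icc]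
  omega

theorem sum_nonzeroIntegers_of_even {A : Type*} [AddCommGroup A] {f : ℤ → A} (hf : f.Even) (K : ℕ) :
    ∑ k ∈ nonzeroIntegers K, f k = 2 • ∑ k ∈ Finset.Icc 1 K, f (k : ℕ) := by
  rw [nonzeroIntegers, Finset.sum_erase_eq_sub (by simp), Finset.sum_Icc_of_even_eq_range hf,
    Finset.sum_range_eq_add_Ico _ K.add_one_pos, Finset.Ico_add_one_right_eq_Icc, Nat.cast_zero,
    smul_add, two_nsmul (f 0)]
  abel

theorem natAbs_le_floor_mul_iff {R γ : ℝ} (hR : 0 ≤ R) (hγ : 0 < γ) (k : ℤ) :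
    k.natAbs ≤ ⌊R * γ⌋₊ ↔ ‖((k / γ : ℝ) : ℂ)‖ ≤ R := by
  rw [Nat.le_floor_iff (by positivity), Complex.norm_real, Real.norm_eq_abs, abs_div,
    abs_of_pos hγ, div_le_iff₀ hγ, Nat.cast_natAbs, Int.cast_abs]

theorem intCast_div_mem_ball {γ δ R : ℝ} (hγ : 0 < γ) (hδ : 0 < δ) (hR : 0 ≤ R)
    (hsep : ∀ n : ℤ, δ ≤ |R * γ - n|) {k : ℤ} (hk : k ∈ nonzeroIntegers ⌊R * γ⌋₊) :
    ((k / γ : ℝ) : ℂ) ∈ Metric.ball 0 R := by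
  rw [mem_ball_zero_iff]
  refine ((natAbs_le_floor_mul_iff hR hγ k).1 (mem_nonzeroIntegers.1 hk).2).lt_of_ne fun heq => ?_
  rw [Complex.norm_real, Real.norm_eq_abs, abs_div, abs_of_pos hγ, div_eq_iff hγ.ne',
    ← Int.cast_abs] at heq
  have hgap := hsep |k|
  rw [heq, sub_self, abs_zero] at hgap
  exact hgap.not_gt hδ

theorem exists_nonzeroIntegers_of_sin_eq_zero {γ R : ℝ} (hγ : 0 < γ) {z : ℂ} (hz0 : z ≠ 0)
    (hz : z ∈ Metric.closedBall 0 R) (hsin : Complex.sin (π * (γ * z)) = 0) :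
    ∃ k ∈ nonzeroIntegers ⌊R * γ⌋₊, z = ((k / γ : ℝ) : ℂ) := by
  have hπC : (π : ℂ) ≠ 0 := Complex.ofReal_ne_zero.2 Real.pi_ne_zero
  have hγC : (γ : ℂ) ≠ 0 := Complex.ofReal_ne_zero.2 hγ.ne'
  obtain ⟨k, hk⟩ := Complex.sin_eq_zero_iff.1 hsin
  have hzk : z = ((k / γ : ℝ) : ℂ) := by
    push_cast
    rw [eq_div_iff hγC]
    refine mul_left_cancel₀ hπC ?_
    linear_combination hk
  rw [mem_closedBall_zero_iff] at hz
  refine ⟨k, mem_nonzeroIntegers.2 ⟨?_, ?_⟩, hzk⟩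
  · rintro rfl
    exact hz0 (by simpa using hzk)
  · exact (natAbs_le_floor_mul_iff ((norm_nonneg z).trans hz) hγ k).2 (hzk ▸ hz)

/-- The poles of `cosSinKernel α β u`: the origin, the points `k / α`, and the points `k / β`,
where `k` runs through the nonzero integers. -/
noncomputable def cosSinPole (α β : ℝ) : Unit ⊕ ℤ ⊕ ℤ → ℂ :=
  Sum.elim (fun _ => 0) (Sum.elim (fun k => ((k / α : ℝ) : ℂ)) fun k => ((k / β : ℝ) : ℂ))

/-- The indices of the poles of `cosSinKernel α β u` in the disc of radius `R` about the origin. -/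
noncomputable def cosSinPoleIndices (α β R : ℝ) : Finset (Unit ⊕ ℤ ⊕ ℤ) :=
  Finset.univ.disjSum ((nonzeroIntegers ⌊R * α⌋₊).disjSum (nonzeroIntegers ⌊R * β⌋₊))

theorem intCast_div_ne_intCast_div {α β : ℝ} (hirr : Irrational (β / α)) {k : ℤ} (hk : k ≠ 0)
    (l : ℤ) : (k / α : ℝ) ≠ l / β := by
  obtain ⟨hβ, hα⟩ := div_ne_zero_iff.1 hirr.ne_zero
  intro heq
  refine (hirr.intCast_mul hk).ne_int l ?_
  rw [div_eq_div_iff hα hβ] at heq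
  rw [← mul_div_assoc, heq, mul_div_cancel_right₀ _ hα]

theorem injOn_cosSinPole {α β : ℝ} (hirr : Irrational (β / α)) (R : ℝ) :
    Set.InjOn (cosSinPole α β) (cosSinPoleIndices α β R) := by
  obtain ⟨hβ, hα⟩ := div_ne_zero_iff.1 hirr.ne_zero
  rintro (_ | k | k) hk (_ | l | l) hl heq <;>
    simp only [cosSinPoleIndices, Finset.mem_coe, Finset.inl_mem_disjSum, Finset.inr_mem_disjSum,
      mem_nonzeroIntegers, cosSinPole, Sum.elim_inl, Sum.elim_inr, Complex.ofReal_inj] at hk hl heq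
  · rfl
  · simp_all [eq_comm (a := (0 : ℂ))]
  · simp_all [eq_comm (a := (0 : ℂ))]
  · simp_all
  · rw [div_left_inj' hα, Int.cast_inj] at heq
    rw [heq]
  · exact absurd heq (intCast_div_ne_intCast_div hirr hk.1 l)
  · simp_all
  · exact absurd heq.symm (intCast_div_ne_intCast_div hirr hl.1 k)
  · rw [div_left_inj' hβ, Int.cast_inj] at heq
    rw [heq]

theorem irrational_div_symm {x y : ℝ} (h : Irrational (y / x)) : Irrational (x / y) :=
  inv_div y x ▸ h.inv

/-- The residue of `cosSinKernel α β u` at `cosSinPole α β i`. -/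
noncomputable def cosSinPoleResidue (α β u : ℝ) : Unit ⊕ ℤ ⊕ ℤ → ℝ :=
  Sum.elim (fun _ => ((α ^ 2 + β ^ 2) / 6 - 2 * u ^ 2) / (α * β))
    (Sum.elim (cosSinResidue α β u) (cosSinResidue β α u))

theorem tendsto_sub_cosSinPole_mul_cosSinKernel {α β : ℝ} (hirr : Irrational (β / α)) (u : ℝ)
    {R : ℝ} {i : Unit ⊕ ℤ ⊕ ℤ} (hi : i ∈ cosSinPoleIndices α β R) :
    Tendsto (fun z => (z - cosSinPole α β i) * cosSinKernel α β u z) (𝓝[≠] cosSinPole α β i)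
      (𝓝 (cosSinPoleResidue α β u i : ℂ)) := by
  obtain ⟨hβ, hα⟩ := div_ne_zero_iff.1 hirr.ne_zero
  rcases i with _ | k | k
  · simpa only [cosSinPole, cosSinPoleResidue, Sum.elim_inl, sub_zero] using
      tendsto_mul_cosSinKernel_zero hα hβ u
  all_goals
    simp only [cosSinPoleIndices, Finset.inr_mem_disjSum, Finset.inl_mem_disjSum,
      mem_nonzeroIntegers] at hi
  · exact tendsto_sub_mul_cosSinKernel hα hirr u hi.1
  · rw [cosSinKernel_comm]
    exact tendsto_sub_mul_cosSinKernel hβ (irrational_div_symm hirr) u hi.1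

theorem circleIntegral_cosSinKernel {α β δ R : ℝ} (hα : 0 < α) (hβ : 0 < β)
    (hirr : Irrational (β / α)) (hδ : 0 < δ) (u : ℝ) (hR0 : 0 < R)
    (hR : R ∈ separatedReals α β δ) :
    (∮ z in C(0, R), cosSinKernel α β u z) =
      (2 * π * Complex.I) *
        ((∑ i ∈ cosSinPoleIndices α β R, cosSinPoleResidue α β u i : ℝ) : ℂ) := by
  rw [Complex.ofReal_sum, circleIntegral_eq_sum_residues hR0.le (injOn_cosSinPole hirr R) ?_ ?_
    fun i hi => tendsto_sub_cosSinPole_mul_cosSinKernel hirr u hi, smul_eq_mul]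
  · rintro (_ | k | k) hi <;>
      simp only [cosSinPoleIndices, Finset.inr_mem_disjSum, Finset.inl_mem_disjSum] at hi
    · exact Metric.mem_ball_self hR0
    · exact intCast_div_mem_ball hα hδ hR0.le (fun n => (hR n).1) hi
    · exact intCast_div_mem_ball hβ hδ hR0.le (fun n => (hR n).2) hi
  · intro z hz hne
    have hz0 : z ≠ 0 := hne (Sum.inl ()) (by simp [cosSinPoleIndices])
    refine differentiableAt_cosSinKernel hα.ne' hβ.ne' u hz0 (fun hsin => ?_) fun hsin => ?_
    · obtain ⟨k, hk, hzk⟩ := exists_nonzeroIntegers_of_sin_eq_zero hα hz0 hz hsin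
      exact hne (Sum.inr (Sum.inl k)) (by simpa [cosSinPoleIndices] using hk) hzk
    · obtain ⟨k, hk, hzk⟩ := exists_nonzeroIntegers_of_sin_eq_zero hβ hz0 hz hsin
      exact hne (Sum.inr (Sum.inr k)) (by simpa [cosSinPoleIndices] using hk) hzk

theorem sum_cosSinPoleResidue (α β u R : ℝ) :
    ∑ i ∈ cosSinPoleIndices α β R, cosSinPoleResidue α β u i =
      ((α ^ 2 + β ^ 2) / 6 - 2 * u ^ 2) / (α * β) +
        2 * (∑ k ∈ Finset.Icc 1 ⌊R * α⌋₊, cosSinResidue α β u (k : ℕ) +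
          ∑ k ∈ Finset.Icc 1 ⌊R * β⌋₊, cosSinResidue β α u (k : ℕ)) := by
  simp only [cosSinPoleIndices, cosSinPoleResidue, Finset.sum_disjSum, Sum.elim_inl, Sum.elim_inr,
    Finset.univ_unique, Finset.sum_singleton]
  rw [sum_nonzeroIntegers_of_even (cosSinResidue_neg α β u),
    sum_nonzeroIntegers_of_even (cosSinResidue_neg β α u), ← nsmul_add, nsmul_eq_mul,
    Nat.cast_ofNat]

theorem tendsto_sum_cosSinResidue {α β δ u : ℝ} (hα : 0 < α) (hβ : 0 < β)
    (hirr : Irrational (β / α)) (hδ : 0 < δ) (hu : 2 * |u| < α + β) :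
    Tendsto (fun R : ℝ => ∑ k ∈ Finset.Icc 1 ⌊R * α⌋₊, cosSinResidue α β u (k : ℕ) +
        ∑ k ∈ Finset.Icc 1 ⌊R * β⌋₊, cosSinResidue β α u (k : ℕ)) (separatedAtTop α β δ)
      (𝓝 ((u ^ 2 - (α ^ 2 + β ^ 2) / 12) / (α * β))) := by
  have hres : Tendsto (fun R => ∑ i ∈ cosSinPoleIndices α β R, cosSinPoleResidue α β u i)
      (separatedAtTop α β δ) (𝓝 0) := by
    have hlim := (Complex.continuous_re.tendsto _).comp
      ((tendsto_circleIntegral_cosSinKernel hα hβ hδ hu).const_mul (2 * π * Complex.I : ℂ)⁻¹)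
    rw [mul_zero, Complex.zero_re] at hlim
    refine hlim.congr' ?_
    filter_upwards [eventually_mem_separatedReals α β δ,
      separatedAtTop_le_atTop α β δ (eventually_gt_atTop 0)] with R hR hR0
    rw [Function.comp_apply, circleIntegral_cosSinKernel hα hβ hirr hδ u hR0 hR,
      inv_mul_cancel_left₀ Complex.two_pi_I_ne_zero, Complex.ofReal_re]
  have hlim := (hres.sub_const (((α ^ 2 + β ^ 2) / 6 - 2 * u ^ 2) / (α * β))).div_const 2
  convert hlim.congr fun R => ?_ using 2
  · ring
  · rw [sum_cosSinPoleResidue]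
    ring

/-! ### The two series -/

/-- The partial sum up to `K` of the first series of the counting formula, in which `α`, `β`, `t`
stand for `log a`, `log b`, `log x`; the second series has `α` and `β` exchanged. -/
noncomputable def cotSum (α β t : ℝ) (K : ℕ) : ℝ :=
  ∑ k ∈ Finset.Icc 1 K, Real.cos (π * k * β / α) * Real.cos (2 * π * k * (t / α)) /
    (k * Real.sin (π * k * β / α))

theorem cotSum_sub_left {α : ℝ} (hα : α ≠ 0) (β t : ℝ) (K : ℕ) :
    cotSum α β (t - α) K = cotSum α β t K := by
  refine Finset.sum_congr rfl fun k _ => ?_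
  rw [sub_div, div_self hα, mul_sub_one, mul_comm (2 * π) (k : ℝ), Real.cos_sub_nat_mul_two_pi]

theorem cos_mul_cos_div_sin {θ : ℝ} (hθ : Real.sin θ ≠ 0) (φ : ℝ) :
    Real.cos θ * Real.cos φ / Real.sin θ = Real.cos (φ + θ) / Real.sin θ + Real.sin φ := by
  rw [Real.cos_add, div_add' _ _ _ hθ]
  ring

theorem pi_mul_cosSinResidue_add_half {α : ℝ} (hα : α ≠ 0) (β s : ℝ) (k : ℤ) :
    π * cosSinResidue α β (s + α / 2) k =
      Real.cos (2 * π * k * (s / α)) / (k * Real.sin (π * k * β / α)) := by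
  have hsin : Real.sin (π * k) = 0 := by rw [mul_comm, Real.sin_int_mul_pi]
  have hcos : Real.cos (2 * π * (s + α / 2) * (k / α)) =
      Real.cos (2 * π * k * (s / α)) * Real.cos (π * k) := by
    rw [show 2 * π * (s + α / 2) * (k / α) = 2 * π * k * (s / α) + π * k by field_simp,
      Real.cos_add, hsin, mul_zero, sub_zero]
  have hcos0 := cos_pi_mul_intCast_ne_zero k
  rw [cosSinResidue, hcos, mul_div_assoc (π * k), mul_div_assoc']
  field_simp

theorem cotSum_eq_add_sawtoothSum {α β : ℝ} (hirr : Irrational (β / α)) (t : ℝ) (K : ℕ) :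
    cotSum α β t K = π * ∑ k ∈ Finset.Icc 1 K, cosSinResidue α β (t + β / 2 + α / 2) (k : ℕ) +
      sawtoothSum (t / α) K := by
  obtain ⟨-, hα⟩ := div_ne_zero_iff.1 hirr.ne_zero
  rw [cotSum, sawtoothSum, Finset.mul_sum, ← Finset.sum_add_distrib]
  refine Finset.sum_congr rfl fun k hk => ?_
  have hsin : Real.sin (π * k * β / α) ≠ 0 := by
    have hk0 : (k : ℤ) ≠ 0 := by have := (Finset.mem_Icc.1 hk).1; omega
    simpa only [Int.cast_natCast, mul_div_assoc] using sin_pi_mul_ne_zero_of_irrational hirr hk0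
  rw [pi_mul_cosSinResidue_add_half hα, Int.cast_natCast, mul_comm (k : ℝ) (Real.sin _),
    ← div_div, ← div_div, ← add_div, cos_mul_cos_div_sin hsin]
  congr 4
  field_simp

theorem cotSum_neg (α β t : ℝ) (K : ℕ) : cotSum α (-β) t K = -cotSum α β t K := by
  simp only [cotSum, mul_neg, neg_div, Real.cos_neg, Real.sin_neg, div_neg, Finset.sum_neg_distrib]

theorem cosSinResidue_neg_right (α β u : ℝ) (k : ℤ) :
    cosSinResidue α (-β) u k = -cosSinResidue α β u k := by
  simp only [cosSinResidue, neg_div, mul_neg, Real.sin_neg, div_neg]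

theorem cotSum_eq_sub_sawtoothSum {α β : ℝ} (hirr : Irrational (β / α)) (t : ℝ) (K : ℕ) :
    cotSum α β t K = π * ∑ k ∈ Finset.Icc 1 K, cosSinResidue α β (t - β / 2 + α / 2) (k : ℕ) -
      sawtoothSum (t / α) K := by
  have hneg := cotSum_eq_add_sawtoothSum (neg_div α β ▸ hirr.neg) t K
  simp only [cotSum_neg, cosSinResidue_neg_right, Finset.sum_neg_distrib, neg_div,
    ← sub_eq_add_neg] at hneg
  linarith

theorem cotSum_sub_right {α β : ℝ} (hirr : Irrational (β / α)) (t : ℝ) (K : ℕ) :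
    cotSum α β (t - β) K =
      cotSum α β t K + (sawtoothSum (t / α) K + sawtoothSum ((t - β) / α) K) := by
  rw [cotSum_eq_add_sawtoothSum hirr, cotSum_eq_sub_sawtoothSum hirr,
    show t - β + β / 2 = t - β / 2 by ring]
  ring

/-! ### Counting lattice points -/

/-- The lattice points `(p, q)` with `p, q ≥ 0` under the line `p α + q β = t`; for `α = log a`,
`β = log b`, `t = log x` these are the pairs with `a ^ p * b ^ q ≤ x`. -/
def latticeTriangle (α β t : ℝ) : Set (ℕ × ℕ) :=
  {pq | pq.1 * α + pq.2 * β ≤ t}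

/-- The combinations `p α + q β` with `p, q ≥ 0`, the logarithmic form of the set `S_{a,b}`. -/
def natCombinations (α β : ℝ) : Set ℝ :=
  {t | ∃ p q : ℕ, t = p * α + q * β}

/-- The number of points of `latticeTriangle α β t`, points on the boundary line counted with
weight one half. -/
noncomputable def starCount (α β t : ℝ) : ℝ :=
  (latticeTriangle α β t).ncard - 1 / 2 * (natCombinations α β).indicator 1 t

theorem starCount_of_neg {α β t : ℝ} (hα : 0 ≤ α) (hβ : 0 ≤ β) (ht : t < 0) :
    starCount α β t = 0 := by
  have hpos (p q : ℕ) : t < p * α + q * β := ht.trans_le (by positivity)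
  have hempty : latticeTriangle α β t = ∅ :=
    Set.eq_empty_of_forall_notMem fun pq => (hpos pq.1 pq.2).not_ge
  have hnotMem : t ∉ natCombinations α β := fun ⟨p, q, h⟩ => (hpos p q).ne h
  rw [starCount, hempty, Set.indicator_of_notMem hnotMem, Set.ncard_empty, Nat.cast_zero, mul_zero,
    sub_zero]

theorem finite_latticeTriangle {α β : ℝ} (hα : 0 < α) (hβ : 0 < β) (t : ℝ) :
    (latticeTriangle α β t).Finite := by
  refine ((Set.finite_Iic ⌊t / α⌋₊).prod (Set.finite_Iic ⌊t / β⌋₊)).subset ?_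
  rintro ⟨p, q⟩ (h : p * α + q * β ≤ t)
  have hp : 0 ≤ p * α := by positivity
  have hq : 0 ≤ q * β := by positivity
  exact ⟨Nat.le_floor ((le_div_iff₀ hα).2 (by linarith)),
    Nat.le_floor ((le_div_iff₀ hβ).2 (by linarith))⟩

theorem latticeTriangle_eq_union {β t : ℝ} (α : ℝ) (hβ : 0 < β) (ht : 0 ≤ t) :
    latticeTriangle α β t =
      Prod.map Nat.succ id '' latticeTriangle α β (t - α) ∪ Prod.mk 0 '' Set.Iic ⌊t / β⌋₊ := by
  ext ⟨p, q⟩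
  rcases p with _ | p
  · simp [latticeTriangle, Nat.le_floor_iff (div_nonneg ht hβ.le), le_div_iff₀ hβ]
  · simp [latticeTriangle, le_sub_iff_add_le, add_mul, add_right_comm]

theorem ncard_latticeTriangle {α β t : ℝ} (hα : 0 < α) (hβ : 0 < β) (ht : 0 ≤ t) :
    (latticeTriangle α β t).ncard = (latticeTriangle α β (t - α)).ncard + (⌊t / β⌋₊ + 1) := by
  have hdisj : Disjoint (Prod.map Nat.succ id '' latticeTriangle α β (t - α))
      (Prod.mk 0 '' Set.Iic ⌊t / β⌋₊) := by
    rw [Set.disjoint_left]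
    rintro _ ⟨pq, -, rfl⟩ ⟨q, -, h⟩
    exact Nat.succ_ne_zero _ (congrArg Prod.fst h).symm
  rw [latticeTriangle_eq_union α hβ ht,
    Set.ncard_union_eq hdisj ((finite_latticeTriangle hα hβ _).image _)
      ((Set.finite_Iic _).image _),
    Set.ncard_image_of_injective _ (Nat.succ_injective.prodMap Function.injective_id),
    Set.ncard_image_of_injective _ (Prod.mk_right_injective 0), Set.ncard_Iic_nat]

theorem natCombinations_eq_union {β : ℝ} (α : ℝ) (hβ : β ≠ 0) :
    natCombinations α β =
      (fun t => t - α) ⁻¹' natCombinations α β ∪ (fun t => t / β) ⁻¹' Set.range ((↑) : ℕ → ℝ) := by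
  ext t
  constructor
  · rintro ⟨_ | p, q, rfl⟩
    · exact Or.inr ⟨q, by simp [hβ]⟩
    · exact Or.inl ⟨p, q, by push_cast; ring⟩
  · rintro (⟨p, q, h⟩ | ⟨q, h⟩)
    · exact ⟨p + 1, q, by push_cast; linarith⟩
    · exact ⟨0, q, by rw [h, div_mul_cancel₀ t hβ]; simp⟩

theorem disjoint_natCombinations {α β : ℝ} (hirr : Irrational (α / β)) :
    Disjoint ((fun t => t - α) ⁻¹' natCombinations α β)
      ((fun t => t / β) ⁻¹' Set.range ((↑) : ℕ → ℝ)) := by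
  have hβ : β ≠ 0 := (div_ne_zero_iff.1 hirr.ne_zero).2
  rw [Set.disjoint_left]
  rintro t ⟨p, q, hpq : t - α = p * α + q * β⟩ ⟨n, hn : (n : ℝ) = t / β⟩
  refine (hirr.natCast_mul p.succ_ne_zero).ne_int (n - q) ?_
  rw [eq_div_iff hβ] at hn
  push_cast
  rw [mul_div_assoc', div_eq_iff hβ]
  linarith

theorem indicator_natCombinations {α β : ℝ} (hirr : Irrational (α / β)) (t : ℝ) :
    (natCombinations α β).indicator (1 : ℝ → ℝ) t =
      (natCombinations α β).indicator 1 (t - α) +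
        (Set.range ((↑) : ℕ → ℝ)).indicator 1 (t / β) := by
  conv_lhs => rw [natCombinations_eq_union α (div_ne_zero_iff.1 hirr.ne_zero).2]
  rw [Set.indicator_union_of_disjoint (disjoint_natCombinations hirr)]
  rfl

theorem floor_add_one_sub_half_indicator {y : ℝ} (hy : 0 ≤ y) :
    (⌊y⌋₊ + 1 : ℝ) - 1 / 2 * (Set.range ((↑) : ℕ → ℝ)).indicator 1 y =
      y + 1 / 2 - bernoulliStar y := by
  by_cases hint : ∃ n : ℤ, y = n
  · obtain ⟨n, rfl⟩ := hint
    lift n to ℕ using Int.cast_nonneg_iff.1 hy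
    rw [bernoulliStar_intCast, Int.cast_natCast, Nat.floor_natCast,
      Set.indicator_of_mem (Set.mem_range_self n), Pi.one_apply]
    ring
  · push Not at hint
    have hnotMem : y ∉ Set.range ((↑) : ℕ → ℝ) := by
      rintro ⟨n, rfl⟩
      exact hint n (Int.cast_natCast n).symm
    rw [bernoulliStar_of_ne hint, Set.indicator_of_notMem hnotMem,
      natCast_floor_eq_intCast_floor hy, ← Int.self_sub_fract]
    ring

theorem starCount_sub {α β t : ℝ} (hα : 0 < α) (hβ : 0 < β) (hirr : Irrational (α / β))
    (ht : 0 ≤ t) :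
    starCount α β (t - α) = starCount α β t - (t / β + 1 / 2 - bernoulliStar (t / β)) := by
  rw [← floor_add_one_sub_half_indicator (div_nonneg ht hβ.le), starCount, starCount,
    ncard_latticeTriangle hα hβ ht, indicator_natCombinations hirr t]
  push_cast
  ring

/-! ### The counting formula -/

/-- The two series truncated at the common height `R`. -/
noncomputable def jointCotSum (α β t R : ℝ) : ℝ :=
  cotSum α β t ⌊R * α⌋₊ + cotSum β α t ⌊R * β⌋₊

/-- `L` is the joint value of the two series: their common truncations tend to `L` along
`separatedReals α β δ` for every `δ > 0`, and for some `δ` these heights are unbounded, so that `L`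
is unique. -/
def IsJointCotSeriesValue (α β t L : ℝ) : Prop :=
  (∃ δ : ℝ, 0 < δ ∧ ∀ M : ℝ, ∃ R ∈ separatedReals α β δ, M ≤ R) ∧
  ∀ δ : ℝ, 0 < δ → Tendsto (jointCotSum α β t) (separatedAtTop α β δ) (𝓝 L)

/-- The value of the two series read off from the counting formula. -/
noncomputable def jointCotValue (α β t : ℝ) : ℝ :=
  2 * π * (t ^ 2 / (2 * α * β) + t / (2 * α) + t / (2 * β) + 1 / 4 + α / (12 * β) + β / (12 * α) -
    1 / 2 * bernoulliStar (t / α) - 1 / 2 * bernoulliStar (t / β) - starCount α β t)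

theorem tendsto_sawtoothSum_floor {γ : ℝ} (hγ : 0 < γ) (α β δ y : ℝ) :
    Tendsto (fun R : ℝ => sawtoothSum y ⌊R * γ⌋₊) (separatedAtTop α β δ)
      (𝓝 (-π * bernoulliStar y)) :=
  (tendsto_sawtoothSum y).comp <|
    (tendsto_nat_floor_atTop.comp (tendsto_id.atTop_mul_const hγ)).mono_left
      (separatedAtTop_le_atTop α β δ)

theorem tendsto_jointCotSum_of_neg {α β t δ : ℝ} (hα : 0 < α) (hβ : 0 < β)
    (hirr : Irrational (β / α)) (hδ : 0 < δ) (ht : -(α + β) < t) (ht0 : t < 0) :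
    Tendsto (jointCotSum α β t) (separatedAtTop α β δ) (𝓝 (jointCotValue α β t)) := by
  have hu : 2 * |t + β / 2 + α / 2| < α + β := by
    rw [← abs_two, ← abs_mul, abs_lt]
    constructor <;> linarith
  have hlim := (((tendsto_sum_cosSinResidue hα hβ hirr hδ hu).const_mul π).add
    (tendsto_sawtoothSum_floor hα α β δ (t / α))).add
    (tendsto_sawtoothSum_floor hβ α β δ (t / β))
  convert hlim.congr fun R => ?_ using 2
  · rw [jointCotValue, starCount_of_neg hα.le hβ.le ht0]
    field_simp
    ring
  · rw [jointCotSum, cotSum_eq_add_sawtoothSum hirr,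
      cotSum_eq_add_sawtoothSum (irrational_div_symm hirr), add_right_comm t]
    ring

theorem jointCotSum_sub {α β : ℝ} (hirr : Irrational (α / β)) (t R : ℝ) :
    jointCotSum α β (t - α) R = jointCotSum α β t R +
      (sawtoothSum (t / β) ⌊R * β⌋₊ + sawtoothSum ((t - α) / β) ⌊R * β⌋₊) := by
  rw [jointCotSum, jointCotSum, cotSum_sub_left (div_ne_zero_iff.1 hirr.ne_zero).1,
    cotSum_sub_right hirr, add_assoc]

theorem jointCotValue_sub {α β t : ℝ} (hα : 0 < α) (hβ : 0 < β) (hirr : Irrational (α / β))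
    (ht : 0 ≤ t) :
    jointCotValue α β (t - α) = jointCotValue α β t +
      (-π * bernoulliStar (t / β) + -π * bernoulliStar ((t - α) / β)) := by
  have hperiod : bernoulliStar ((t - α) / α) = bernoulliStar (t / α) := by
    rw [sub_div, div_self hα.ne', bernoulliStar_sub_one]
  rw [jointCotValue, jointCotValue, starCount_sub hα hβ hirr ht, hperiod]
  field_simp
  ring

theorem tendsto_jointCotSum_of_sub {α β t δ : ℝ} (hα : 0 < α) (hβ : 0 < β)
    (hirr : Irrational (α / β)) (ht : 0 ≤ t)
    (h : Tendsto (jointCotSum α β (t - α)) (separatedAtTop α β δ) (𝓝 (jointCotValue α β (t - α)))) :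
    Tendsto (jointCotSum α β t) (separatedAtTop α β δ) (𝓝 (jointCotValue α β t)) := by
  have hlim := h.sub ((tendsto_sawtoothSum_floor hβ α β δ (t / β)).add
    (tendsto_sawtoothSum_floor hβ α β δ ((t - α) / β)))
  rw [jointCotValue_sub hα hβ hirr ht, add_sub_cancel_right] at hlim
  exact hlim.congr fun R => by rw [jointCotSum_sub hirr, add_sub_cancel_right]

theorem tendsto_jointCotSum {α β t δ : ℝ} (hα : 0 < α) (hβ : 0 < β) (hirr : Irrational (β / α))
    (hδ : 0 < δ) (ht : -(α + β) < t) :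
    Tendsto (jointCotSum α β t) (separatedAtTop α β δ) (𝓝 (jointCotValue α β t)) := by
  obtain ⟨n, hn⟩ := exists_nat_gt (t / α)
  rw [div_lt_iff₀ hα] at hn
  induction n generalizing t with
  | zero => exact tendsto_jointCotSum_of_neg hα hβ hirr hδ ht (by simpa using hn)
  | succ n ih =>
    rcases lt_or_ge t 0 with ht0 | ht0
    · exact tendsto_jointCotSum_of_neg hα hβ hirr hδ ht ht0
    · refine tendsto_jointCotSum_of_sub hα hβ (irrational_div_symm hirr) ht0 (ih ?_ ?_)
      · linarith
      · rw [Nat.cast_succ, add_one_mul] at hn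
        linarith

theorem corollary14_general {α β t : ℝ} (hα : 0 < α) (hβ : 0 < β) (hirr : Irrational (β / α))
    (ht : -(α + β) < t) :
    ∃ L : ℝ, IsJointCotSeriesValue α β t L ∧
      ((latticeTriangle α β t).ncard : ℝ) =
        t ^ 2 / (2 * α * β) + t / (2 * α) + t / (2 * β)
          + 1 / 4 + α / (12 * β) + β / (12 * α)
          - 1 / 2 * bernoulliStar (t / α)
          - 1 / 2 * bernoulliStar (t / β)
          - 1 / (2 * π) * L
          + 1 / 2 * (natCombinations α β).indicator 1 t := by
  refine ⟨jointCotValue α β t, ⟨⟨1 / 8, by norm_num, exists_mem_separatedReals hα hβ⟩,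
    fun δ hδ => tendsto_jointCotSum hα hβ hirr hδ ht⟩, ?_⟩
  rw [jointCotValue, starCount, ← mul_assoc, one_div_mul_cancel Real.two_pi_pos.ne']
  ring

theorem irrational_log_div_log {a b : ℕ} (ha : 1 < a) (hb : 1 < b) (hab : Nat.Coprime a b) :
    Irrational (Real.log b / Real.log a) := by
  have hloga : 0 < Real.log a := Real.log_pos (by exact_mod_cast ha)
  have hlogb : 0 < Real.log b := Real.log_pos (by exact_mod_cast hb)
  rintro ⟨r, hr⟩
  have hr0 : (0 : ℝ) ≤ r := hr ▸ by positivity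
  lift r to ℚ≥0 using by exact_mod_cast hr0
  have hden : (r.den : ℝ) ≠ 0 := by exact_mod_cast r.den_ne_zero
  have hr' : (r.num / r.den : ℝ) = Real.log b / Real.log a := by
    rw [← hr, ← NNRat.cast_def]
    norm_cast
  rw [div_eq_div_iff hden hloga.ne', mul_comm (Real.log b), ← Real.log_pow, ← Real.log_pow] at hr'
  have hpow : a ^ r.num = b ^ r.den := by
    exact_mod_cast Real.log_injOn_pos (Set.mem_Ioi.2 (by positivity))
      (Set.mem_Ioi.2 (by positivity)) hr'
  have hcoprime : Nat.Coprime (a ^ r.num) (b ^ r.den) := hab.pow _ _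
  rw [hpow, Nat.coprime_self] at hcoprime
  exact (Nat.one_lt_pow r.den_ne_zero hb).ne' hcoprime

theorem log_pow_mul_pow {a b : ℝ} (ha : a ≠ 0) (hb : b ≠ 0) (p q : ℕ) :
    Real.log (a ^ p * b ^ q) = p * Real.log a + q * Real.log b := by
  rw [Real.log_mul (pow_ne_zero p ha) (pow_ne_zero q hb), Real.log_pow, Real.log_pow]

theorem countN_eq_ncard_latticeTriangle {a b : ℕ} (ha : 0 < a) (hb : 0 < b) {x : ℝ} (hx : 0 < x) :
    countN a b x = (latticeTriangle (Real.log a) (Real.log b) (Real.log x)).ncard := by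
  refine congrArg Set.ncard (Set.ext fun ⟨p, q⟩ => ?_)
  change (a : ℝ) ^ p * (b : ℝ) ^ q ≤ x ↔ p * Real.log a + q * Real.log b ≤ Real.log x
  rw [← log_pow_mul_pow (by positivity) (by positivity), Real.log_le_log_iff (by positivity) hx]

theorem chiS_eq_indicator_natCombinations {a b : ℕ} (ha : 0 < a) (hb : 0 < b) {x : ℝ}
    (hx : 0 < x) :
    chiS a b x = (natCombinations (Real.log a) (Real.log b)).indicator 1 (Real.log x) := by
  have hmem : x ∈ smoothSet a b ↔ Real.log x ∈ natCombinations (Real.log a) (Real.log b) := by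
    refine exists₂_congr fun p q => ?_
    rw [← log_pow_mul_pow (by positivity) (by positivity)]
    exact (Real.log_injOn_pos.eq_iff hx (Set.mem_Ioi.2 (by positivity))).symm
  classical
  rw [chiS, Set.indicator_apply, Set.indicator_apply, Pi.one_apply]
  exact if_congr hmem rfl rfl

theorem corollary14 :
    (∀ a b : ℕ, 1 < a → a < b → Nat.Coprime a b → ∀ x : ℝ, 1 ≤ x →
      ∃ L : ℝ, IsSeriesValue a b x L ∧
        (countN a b x : ℝ) =
          Real.log x ^ 2 / (2 * Real.log a * Real.log b)
            + Real.log x / (2 * Real.log a) + Real.log x / (2 * Real.log b)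
            + 1 / 4 + Real.log a / (12 * Real.log b) + Real.log b / (12 * Real.log a)
            - 1 / 2 * bernoulliStar (Real.log x / Real.log a)
            - 1 / 2 * bernoulliStar (Real.log x / Real.log b)
            - 1 / (2 * Real.pi) * L
            + 1 / 2 * chiS a b x) ∧
    (∀ x : ℝ, 1 ≤ x →
      ∃ L : ℝ, IsSeriesValue 2 3 x L ∧
        (countN 2 3 x : ℝ) =
          Real.log x ^ 2 / (2 * Real.log 2 * Real.log 3)
            + Real.log x / (2 * Real.log 2) + Real.log x / (2 * Real.log 3)
            + 1 / 4 + Real.log 2 / (12 * Real.log 3) + Real.log 3 / (12 * Real.log 2)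
            - 1 / 2 * bernoulliStar (Real.log x / Real.log 2)
            - 1 / 2 * bernoulliStar (Real.log x / Real.log 3)
            - 1 / (2 * Real.pi) * L
            + 1 / 2 * chiS 2 3 x) := by
  refine (and_iff_left_of_imp fun h x hx => ?_).2 fun a b ha hab hcop x hx => ?_
  · simpa only [Nat.cast_ofNat] using
      h 2 3 (by norm_num) (by norm_num) (by norm_num) x hx
  · have hb := ha.trans hab
    have hx0 : 0 < x := by linarith
    have hα : 0 < Real.log a := Real.log_pos (by exact_mod_cast ha)
    have hβ : 0 < Real.log b := Real.log_pos (by exact_mod_cast hb)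
    rw [countN_eq_ncard_latticeTriangle (by omega) (by omega) hx0,
      chiS_eq_indicator_natCombinations (by omega) (by omega) hx0]
    exact corollary14_general hα hβ (irrational_log_div_log ha hb hcop)
      (by linarith [Real.log_nonneg hx])
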